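/- Let $\mathcal A=\mathbb R[\sigma_1^{\pm1},\dots,\sigma_n^{\pm1}]$, and for $0\le d'\le n$ let $\mathcal A_{d'}=\mathbb R[\sigma_1^{\pm1},\dots,\sigma_{d'}^{\pm1}]\subseteq\mathcal A$. A Laurent polynomial acts on sequences $w:\mathbb Z^n\to\mathbb R$ through the shifts $(\sigma^{\mu}w)(\nu)=w(\nu+\mu)$, and a row $r\in\mathcal A^q$ acts on columns $w=(w_1,\dots,w_q)$ of sequences by $rw=\sum_i r_iw_i$. For a matrix $R\in\mathcal A^{p\times q}$ put $\ker R=\{w:\mathbb Z^n\to\mathbb R^q \mid Rw=0\}$. The characteristic ideal of $\ker R$ is the ideal of $\mathcal A$ generated by the $q\times q$ minors of $R$ (the zero ideal if $p<q$), and $\ker R$ is called autonomous if this ideal is nonzero. For $T\in\mathrm{GL}_n(\mathbb Z)$ (a unimodular integer matrix) let $\varphi_T:\mathcal A\to\mathcal A$ be the $\mathbb R$-algebra automorphism $\sigma^\nu\mapsto\sigma^{T\nu}$, and let $\widehat\varphi_T:\mathcal A^q\to\mathcal A^q$ be its entrywise extension. Let $\mathcal R\subseteq\mathcal A^q$ be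 a submodule whose behavior $\mathfrak B=\{w:\mathbb Z^n\to\mathbb R^q\mid rw=0\text{ for all }r\in\mathcal R\}$ is autonomous, and let $d$ be the Krull dimension of $\mathcal A/\mathrm{ann}(\mathcal A^q/\mathcal R)$ (equal to $-\infty$ if $\mathcal R=\mathcal A^q$). If $\mathcal A^q/\widehat\varphi_T(\mathcal R)$ is finitely generated over $\mathcal A_{d'}$, then generators $g_1,\dots,g_\gamma$ of it over $\mathcal A_{d'}$, together with a matrix $X\in\mathcal A_{d'}^{\delta\times\gamma}$ whose rows generate the module of relations $\{c\in\mathcal A_{d'}^{\gamma}\mid\sum_i c_ig_i=0\}$, define a state space $\mathbb X=\{x:\mathbb Z^{d'}\to\mathbb R^\gamma\mid Xx=0\}$, which is a $d'$-dimensional behavior. Then: 1. For every $0\le d'\le n$, there exists a unimodular $T\in\mathbb Z^{n\times n}$ such that $\mathcal A^q/\widehat\varphi_T(\mathcal R)$ is finitely generated over $\mathcal A_{d'}$ with non-autonomous state space $\mathbb X$ if and only if $d'=d$. This holds both when non-autonomy is required of $\mathbb X$ for every choice of generators and relation matrix, and when it is required for some choice only. 2. For every $0\le d'\le n$, there exists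 a unimodular $T\in\mathbb Z^{n\times n}$ such that $\mathcal A^q/\widehat\varphi_T(\mathcal R)$ is finitely generated over $\mathcal A_{d'}$ if and only if $d'\ge d$. 3. $d$ is the dimension of the characteristic variety of $\mathfrak B$: for every matrix $R$ over $\mathcal A$ with $q$ columns and $\mathfrak B=\ker R$, the set of common zeros in $(\mathbb C^\times)^n$ of the $q\times q$ minors of $R$ (all of $(\mathbb C^\times)^n$ if $R$ has fewer than $q$ rows) has dimension $d$. Here the dimension of $V\subseteq(\mathbb C^\times)^n$ is the Krull dimension of $\mathbb C[\sigma_1^{\pm1},\dots,\sigma_n^{\pm1}]$ modulo the ideal of the Laurent polynomials that vanish on $V$. -/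

import Mathlib

namespace NDSystems

/-- The Laurent polynomial ring `ℝ[σ₁^{±1}, …, σₙ^{±1}]`, as the group algebra of `ℤⁿ`; the monomial
`σ^ν` is `AddMonoidAlgebra.single ν 1`. -/
abbrev Laurent (n : ℕ) : Type := AddMonoidAlgebra ℝ (Fin n → ℤ)

/-- Scalar `n`-D trajectories: real sequences indexed by `ℤⁿ`. -/
abbrev Traj (n : ℕ) : Type := (Fin n → ℤ) → ℝ

/-- The action of Laurent polynomials on scalar trajectories for which `σ^μ` is the shift
`(σ^μ w)(ν) = w (ν + μ)`. -/
noncomputable def shiftAct {n : ℕ} (f : Laurent n) (w : Traj n) : Traj n :=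
  fun ν => f.coeff.sum fun μ a => a * w (ν + μ)

/-- The action `r w = ∑ i, rᵢ wᵢ` of a row vector on a column of trajectories. -/
noncomputable def rowAct {n q : ℕ} (r : Fin q → Laurent n) (w : Fin q → Traj n) : Traj n :=
  ∑ i, shiftAct (r i) (w i)

/-- The behavior `{w | r w = 0 for all r ∈ 𝓡}` with equation module `𝓡`. -/
def behavior {n q : ℕ} (𝓡 : Submodule (Laurent n) (Fin q → Laurent n)) : Set (Fin q → Traj n) :=
  {w | ∀ r ∈ 𝓡, rowAct r w = 0}

/-- The behavior `ker R(σ) = {w | R(σ) w = 0}` of a matrix of difference operators. -/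
def kerRep {n p q : ℕ} (R : Matrix (Fin p) (Fin q) (Laurent n)) : Set (Fin q → Traj n) :=
  {w | ∀ k, rowAct (R k) w = 0}

/-- The ideal generated by the `q × q` minors of a matrix with `q` columns
(the zero ideal if there are fewer than `q` rows). -/
noncomputable def minorIdeal {n p q : ℕ} (R : Matrix (Fin p) (Fin q) (Laurent n)) : Ideal (Laurent n) :=
  Ideal.span (Set.range fun e : Fin q ↪o Fin p => (R.submatrix e id).det)

/-- A behavior is autonomous if it is the kernel of a matrix with nonzero characteristic ideal. -/
def IsAutonomous {n q : ℕ} (𝓑 : Set (Fin q → Traj n)) : Prop :=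
  ∃ (p : ℕ) (R : Matrix (Fin p) (Fin q) (Laurent n)), 𝓑 = kerRep R ∧ minorIdeal R ≠ ⊥

/-- The `ℝ`-algebra map `φ_T : σ^ν ↦ σ^{T ν}`. -/
noncomputable def phi {n : ℕ} (T : Matrix (Fin n) (Fin n) ℤ) : Laurent n →ₐ[ℝ] Laurent n :=
  AddMonoidAlgebra.mapDomainAlgHom ℝ ℝ T.mulVecLin.toAddMonoidHom

theorem phi_phi_inv {n : ℕ} (T : Matrix.GeneralLinearGroup (Fin n) ℤ) (f : Laurent n) :
    phi (T : Matrix (Fin n) (Fin n) ℤ) (phi ((T⁻¹ : Matrix.GeneralLinearGroup (Fin n) ℤ) :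
      Matrix (Fin n) (Fin n) ℤ) f) = f := by
  have h : (phi (T : Matrix (Fin n) (Fin n) ℤ)).comp
      (phi ((T⁻¹ : Matrix.GeneralLinearGroup (Fin n) ℤ) : Matrix (Fin n) (Fin n) ℤ)) =
      AlgHom.id ℝ _ := by
    rw [phi, phi, ← AddMonoidAlgebra.mapDomainAlgHom_comp, ← AddMonoidAlgebra.mapDomainAlgHom_id]
    congr 1
    refine AddMonoidHom.ext fun ν => ?_
    change (T : Matrix (Fin n) (Fin n) ℤ).mulVec
      (((T⁻¹ : Matrix.GeneralLinearGroup (Fin n) ℤ) : Matrix (Fin n) (Fin n) ℤ).mulVec ν) = ν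
    rw [Matrix.mulVec_mulVec, ← Units.val_mul, mul_inv_cancel, Units.val_one, Matrix.one_mulVec]
  exact DFunLike.congr_fun h f

/-- The image `φ̂_T(𝓡)` of a submodule under the entrywise application of `φ_T`, for a unimodular
integer matrix `T` (an element of `GL(n, ℤ)`, that is, of determinant `±1`). -/
def transform {n q : ℕ} (T : Matrix.GeneralLinearGroup (Fin n) ℤ)
    (𝓡 : Submodule (Laurent n) (Fin q → Laurent n)) :
    Submodule (Laurent n) (Fin q → Laurent n) where
  carrier := (fun r i => phi (T : Matrix (Fin n) (Fin n) ℤ) (r i)) '' (𝓡 : Set (Fin q → Laurent n))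
  add_mem' := by
    rintro _ _ ⟨r, hr, rfl⟩ ⟨s, hs, rfl⟩
    exact ⟨r + s, 𝓡.add_mem hr hs, by ext1 i; simp⟩
  zero_mem' := ⟨0, 𝓡.zero_mem, by ext1 i; simp⟩
  smul_mem' := by
    rintro c _ ⟨r, hr, rfl⟩
    refine ⟨phi ((T⁻¹ : Matrix.GeneralLinearGroup (Fin n) ℤ) : Matrix (Fin n) (Fin n) ℤ) c • r,
      𝓡.smul_mem _ hr, ?_⟩
    ext1 i
    simp only [Pi.smul_apply, smul_eq_mul, map_mul, phi_phi_inv]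

/-- Extension of integer vectors by zero, `(ν₁, …, ν_d) ↦ (ν₁, …, ν_d, 0, …, 0)`. -/
def extendZero (d n : ℕ) : (Fin d → ℤ) →+ (Fin n → ℤ) where
  toFun ν i := if h : (i : ℕ) < d then ν ⟨i, h⟩ else 0
  map_zero' := by ext i; simp
  map_add' ν μ := by ext i; by_cases h : (i : ℕ) < d <;> simp [h]

/-- For `d ≤ n`, the inclusion of the Laurent polynomial ring in the first `d` shifts into the
Laurent polynomial ring in all `n` shifts. -/
noncomputable def incl (d n : ℕ) : Laurent d →+* Laurent n :=
  AddMonoidAlgebra.mapDomainRingHom ℝ (extendZero d n)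

/-- `M` is finitely generated as a module over `A`, where `A` acts through `f : A → B`. -/
def FinGenOver {A B : Type*} [CommRing A] [CommRing B] (f : A →+* B) (M : Type*) [AddCommGroup M]
    [Module B M] : Prop :=
  letI : Module A M := Module.compHom M f
  Module.Finite A M

/-- With `A` acting on `M` through `f : A → B`, the tuple `g` generates `M` over `A`, and the rows of
`X` generate the module of relations `{c | ∑ i, cᵢ gᵢ = 0}`, the kernel of `A^γ → M`, `eᵢ ↦ gᵢ`;
that is, `X` is a matrix of relations of the generators `g`. -/
def IsPresentation {A B : Type*} [CommRing A] [CommRing B] (f : A →+* B) {M : Type*}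
    [AddCommGroup M] [Module B M] {γ δ : ℕ} (g : Fin γ → M) (X : Matrix (Fin δ) (Fin γ) A) : Prop :=
  letI : Module A M := Module.compHom M f
  Submodule.span A (Set.range g) = ⊤ ∧
    Submodule.span A (Set.range fun k => X k) = LinearMap.ker (Fintype.linearCombination A g)

/-- Evaluation at a point of the torus `(ℂ^×)ⁿ` of Laurent polynomials with coefficients in `K`. -/
noncomputable def evalAt (K : Type) [CommSemiring K] [Algebra K ℂ] {n : ℕ} (ξ : Fin n → ℂˣ) :
    AddMonoidAlgebra K (Fin n → ℤ) →ₐ[K] ℂ :=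
  AddMonoidAlgebra.lift K ℂ (Fin n → ℤ)
    { toFun := fun ν => ((∏ i, ξ i ^ (Multiplicative.toAdd ν i) : ℂˣ) : ℂ)
      map_one' := by simp
      map_mul' := fun ν μ => by simp [zpow_add, Finset.prod_mul_distrib] }

/-- The set of common zeros in `(ℂ^×)ⁿ` of an ideal of real Laurent polynomials. -/
def zeroSet {n : ℕ} (I : Ideal (Laurent n)) : Set (Fin n → ℂˣ) :=
  {ξ | ∀ f ∈ I, evalAt ℝ ξ f = 0}

/-- The ideal of the complex Laurent polynomials that vanish on `V ⊆ (ℂ^×)ⁿ`. -/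
noncomputable def vanishingIdeal {n : ℕ} (V : Set (Fin n → ℂˣ)) :
    Ideal (AddMonoidAlgebra ℂ (Fin n → ℤ)) :=
  ⨅ ξ ∈ V, RingHom.ker (evalAt ℂ ξ)

/-- The dimension of a closed subvariety of `(ℂ^×)ⁿ`: the Krull dimension of its coordinate ring. -/
noncomputable def varietyDim {n : ℕ} (V : Set (Fin n → ℂˣ)) : WithBot ℕ∞ :=
  ringKrullDim (AddMonoidAlgebra ℂ (Fin n → ℤ) ⧸ vanishingIdeal V)

end NDSystems

open NDSystems

/-! Let I = ann(𝒜^q/𝓡), and let `twistedIncl` be the composite 𝒜_{d'} → 𝒜 → 𝒜 → 𝒜/I of inclusion,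
φ_{T⁻¹} and projection. Parts 1 and 2 are statements about this ring map. By Cayley–Hamilton,
𝒜^q/φ̂_T(𝓡) is finite over 𝒜_{d'} iff the map is integral (`finGenOver_transform_iff`). The cokernel
of a relation matrix is this same module, and a behavior is autonomous iff the cokernel of its
equations has nonzero annihilator. So the state space of any presentation is non-autonomous iff the
map is injective (`not_isAutonomous_kerRep_iff`).

Since 𝒜_{d'} has Krull dimension d', integrality forces d ≤ d', and integrality with injectivity
forces d = d'. Existence of T is Noether normalization by monomial substitutions
(`exists_isIntegral_injective`): a suitable shear of the exponents turns a nonzero element of the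
kernel into a polynomial in the last variable whose coefficients are monomials, hence units, so that
this variable and its inverse become integral over the others.

Real linear forms on 𝒜^q are trajectories, so a behavior determines its equation module
(`behavior_injective`). For part 3, the minors and the annihilator of the cokernel have the same
zeros, and the Nullstellensatz together with the integrality of the complex over the real Laurent
polynomials identifies the dimension of the zero set with that of 𝒜/I (`varietyDim_zeroSet`). -/

namespace NDSystems

/-! ### Krull dimension along integral ring maps. -/

section Integral

variable {A B : Type*} [CommRing A] [CommRing B]

/-- Incomparability: contraction of primes is strictly monotone along an integral map. -/
theorem ringKrullDim_le_of_isIntegral (f : A →+* B) (hf : f.IsIntegral) :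
    ringKrullDim B ≤ ringKrullDim A := by
  algebraize [f]
  exact Order.krullDim_le_of_strictMono (PrimeSpectrum.comap (algebraMap A B))
    fun I J h => Ideal.IsIntegral.comap_lt_comap (R := A) (I := I.asIdeal) (J := J.asIdeal) h

/-- Lying over lifts the bottom prime of a chain, and going up lifts the rest. -/
theorem ringKrullDim_eq_of_isIntegral_of_injective (f : A →+* B) (hf : f.IsIntegral)
    (hinj : Function.Injective f) : ringKrullDim B = ringKrullDim A := by
  refine le_antisymm (ringKrullDim_le_of_isIntegral f hf) ?_
  algebraize [f]
  refine iSup_le fun l => ?_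
  obtain ⟨Q, -, hQ, hQl⟩ := Ideal.exists_ideal_over_prime_of_isIntegral (S := B) l.head.asIdeal ⊥
    (by
      rw [← RingHom.ker_eq_comap_bot, (RingHom.injective_iff_ker_eq_bot (algebraMap A B)).1 hinj]
      exact bot_le)
  have : Q.LiesOver l.head.asIdeal := ⟨hQl.symm⟩
  obtain ⟨L, hL, -⟩ := Ideal.exists_ltSeries_of_hasGoingUp l Q
  rw [← hL]
  exact le_iSup (fun L : LTSeries (PrimeSpectrum B) => (L.length : WithBot ℕ∞)) L

theorem ringKrullDim_quotient_radical (I : Ideal A) :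
    ringKrullDim (A ⧸ I.radical) = ringKrullDim (A ⧸ I) := by
  rw [ringKrullDim_quotient, ringKrullDim_quotient, PrimeSpectrum.zeroLocus_radical]

end Integral

/-! ### The Laurent polynomial ring and its Krull dimension. -/

section Laurent

variable {n : ℕ}

instance : IsNoetherianRing (Laurent n) := Algebra.FiniteType.isNoetherianRing ℝ _

instance : IsJacobsonRing (Laurent n) :=
  (Algebra.FiniteType.iff_quotient_mvPolynomial''.1
    (inferInstance : Algebra.FiniteType ℝ (Laurent n))).elim fun _ ⟨f, hf⟩ =>
      isJacobsonRing_of_surjective ⟨f.toRingHom, hf⟩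

/-- A subring that contains the images of the constants and of the variables and their inverses
contains the image of every Laurent polynomial. -/
theorem map_mem_of_forall_single {K B : Type*} [CommRing K] [CommRing B]
    (g : AddMonoidAlgebra K (Fin n → ℤ) →+* B) (S : Subring B)
    (hK : ∀ a : K, g (AddMonoidAlgebra.single 0 a) ∈ S)
    (hpos : ∀ i, g (AddMonoidAlgebra.single (Pi.single i 1) 1) ∈ S)
    (hneg : ∀ i, g (AddMonoidAlgebra.single (Pi.single i (-1)) 1) ∈ S)
    (f : AddMonoidAlgebra K (Fin n → ℤ)) : g f ∈ S := by
  have hz : ∀ i (k : ℤ), g (AddMonoidAlgebra.single (Pi.single i k) 1) ∈ S := by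
    intro i k
    induction k with
    | zero => simpa using hK 1
    | succ k ih =>
      have := S.mul_mem ih (hpos i)
      rwa [← map_mul, AddMonoidAlgebra.single_mul_single, one_mul, ← Pi.single_add] at this
    | pred k ih =>
      have := S.mul_mem ih (hneg i)
      rwa [← map_mul, AddMonoidAlgebra.single_mul_single, one_mul, ← Pi.single_add,
        ← sub_eq_add_neg] at this
  have hs : ∀ (s : Finset (Fin n)) (ν : Fin n → ℤ),
      g (AddMonoidAlgebra.single (∑ i ∈ s, Pi.single i (ν i)) 1) ∈ S := by
    intro s ν
    induction s using Finset.induction_on with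
    | empty => simpa using hK 1
    | insert i s hi ih =>
      have := S.mul_mem (hz i (ν i)) ih
      rwa [← map_mul, AddMonoidAlgebra.single_mul_single, one_mul,
        ← Finset.sum_insert (f := fun i => Pi.single i (ν i)) hi] at this
  induction f using AddMonoidAlgebra.induction_linear with
  | zero => simp
  | add f g hf hg => simpa using S.add_mem hf hg
  | single ν a =>
    have h1 := hs Finset.univ ν
    rw [Finset.univ_sum_single] at h1
    have := S.mul_mem (hK a) h1
    rwa [← map_mul, AddMonoidAlgebra.single_mul_single, zero_add, mul_one] at this

/-- With sᵢ = σᵢ + σᵢ⁻¹, both σᵢ and σᵢ⁻¹ are roots of X² - sᵢX + 1, so 𝒜 is integral over a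
polynomial ring in n variables. -/
theorem ringKrullDim_laurent_le (n : ℕ) : ringKrullDim (Laurent n) ≤ n := by
  let s (i : Fin n) : Laurent n := AddMonoidAlgebra.single (Pi.single i 1) 1 +
    AddMonoidAlgebra.single (Pi.single i (-1)) 1
  let φ : MvPolynomial (Fin n) ℝ →+* Laurent n := (MvPolynomial.aeval s).toRingHom
  have key : φ.IsIntegral := by
    algebraize [φ]
    have hroot : ∀ x y : Laurent n, x * y = 1 → (∃ i, x + y = s i) →
        x ∈ integralClosure (MvPolynomial (Fin n) ℝ) (Laurent n) := by
      rintro x y hxy ⟨i, hi⟩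
      refine ⟨.X ^ 2 - .C (.X i) * .X + 1, by monicity!, ?_⟩
      have : algebraMap (MvPolynomial (Fin n) ℝ) (Laurent n) (.X i) = x + y := by
        rw [hi]; exact MvPolynomial.aeval_X _ _
      simp only [Polynomial.eval₂_add, Polynomial.eval₂_sub, Polynomial.eval₂_mul,
        Polynomial.eval₂_pow, Polynomial.eval₂_X, Polynomial.eval₂_C, Polynomial.eval₂_one, this]
      linear_combination -hxy
    intro x
    refine map_mem_of_forall_single (RingHom.id _)
      (integralClosure (MvPolynomial (Fin n) ℝ) (Laurent n)).toSubring (fun a => ?_) (fun i => ?_)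
      (fun i => ?_) x
    · have : AddMonoidAlgebra.single 0 a =
          algebraMap (MvPolynomial (Fin n) ℝ) (Laurent n) (.C a) :=
        (MvPolynomial.aeval_C s a).symm
      rw [this]
      exact Subalgebra.algebraMap_mem _ _
    · refine hroot _ (AddMonoidAlgebra.single (Pi.single i (-1)) 1) ?_ ⟨i, rfl⟩
      rw [RingHom.id_apply, AddMonoidAlgebra.single_mul_single, ← Pi.single_add]
      simp [AddMonoidAlgebra.one_def]
    · refine hroot _ (AddMonoidAlgebra.single (Pi.single i 1) 1) ?_ ⟨i, add_comm _ _⟩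
      rw [RingHom.id_apply, AddMonoidAlgebra.single_mul_single, ← Pi.single_add]
      simp [AddMonoidAlgebra.one_def]
  refine (ringKrullDim_le_of_isIntegral φ key).trans ?_
  rw [MvPolynomial.ringKrullDim_of_isNoetherianRing, ringKrullDim_eq_zero_of_field]
  simp

/-- Setting the last variable to 1 is a surjection that kills the nonzerodivisor σₙ₊₁ - 1, which
costs at least one dimension. -/
theorem le_ringKrullDim_laurent (n : ℕ) : (n : WithBot ℕ∞) ≤ ringKrullDim (Laurent n) := by
  induction n with
  | zero => exact ringKrullDim_nonneg_of_nontrivial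
  | succ n ih =>
    obtain ⟨i, hi⟩ : ∃ i : (Fin (n + 1) → ℤ) →+ (Fin n → ℤ), ∀ ν, i ν = Fin.init ν :=
      ⟨{ toFun := fun ν => Fin.init ν, map_zero' := rfl, map_add' := fun _ _ => rfl }, fun _ => rfl⟩
    let π : Laurent (n + 1) →+* Laurent n := AddMonoidAlgebra.mapDomainRingHom ℝ i
    have hπ : Function.Surjective π := by
      intro f
      induction f using AddMonoidAlgebra.induction_linear with
      | zero => exact ⟨0, map_zero _⟩
      | add f g hf hg =>
        obtain ⟨a, rfl⟩ := hf
        obtain ⟨b, rfl⟩ := hg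
        exact ⟨a + b, map_add _ _ _⟩
      | single ν a =>
        refine ⟨AddMonoidAlgebra.single (Fin.snoc ν 0) a, ?_⟩
        simp [π, hi]
    let r : Laurent (n + 1) := AddMonoidAlgebra.single (Pi.single (Fin.last n) 1) 1 - 1
    have hr : r ≠ 0 := by
      rw [sub_ne_zero, AddMonoidAlgebra.one_def]
      intro h
      have := (AddMonoidAlgebra.single_left_injective (R := ℝ) one_ne_zero) h
      simp at this
    have hr' : π r = 0 := by
      have : i (Pi.single (Fin.last n) 1) = 0 := by
        ext j
        simp [hi, Fin.init]
      rw [map_sub, map_one, sub_eq_zero, AddMonoidAlgebra.one_def]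
      exact (AddMonoidAlgebra.mapDomain_single).trans (by rw [this])
    refine le_trans ?_ (ringKrullDim_succ_le_of_surjective π hπ
      (mem_nonZeroDivisors_of_ne_zero hr) hr')
    push_cast
    gcongr

theorem ringKrullDim_laurent (n : ℕ) : ringKrullDim (Laurent n) = n :=
  le_antisymm (ringKrullDim_laurent_le n) (le_ringKrullDim_laurent n)

end Laurent

/-! ### Noether normalization by automorphisms of the exponent lattice. -/

section Noether

open Polynomial in
/-- A unit that satisfies a Laurent polynomial equation with unit coefficients and pairwise
distinct exponents is integral. -/
theorem isIntegralElem_of_sum_zpow_eq_zero {A B ι : Type*} [CommRing A] [CommRing B] (f : A →+* B)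
    (y : Bˣ) (S : Finset ι) (hS : S.Nonempty) (u : ι → A) (hu : ∀ i ∈ S, IsUnit (u i)) (l : ι → ℤ)
    (hl : Set.InjOn l S) (h : ∑ i ∈ S, f (u i) * (y ^ l i : Bˣ) = 0) :
    f.IsIntegralElem (y : B) := by
  classical
  obtain ⟨j, hj, hjmax⟩ := S.exists_max_image l hS
  obtain ⟨j', -, hmin⟩ := S.exists_min_image l hS
  obtain ⟨v, hv⟩ := hu j hj
  -- Multiplying the relation by the unit y^(-min l) makes the exponents natural numbers; dividing
  -- by the unit coefficient of the largest exponent makes it monic.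
  let N (i : ι) : ℕ := (l i - l j').toNat
  have hN : ∀ i ∈ S, (N i : ℤ) = l i - l j' := fun i hi =>
    Int.toNat_of_nonneg (sub_nonneg.2 (hmin i hi))
  let p : A[X] := ∑ i ∈ S, C ((v⁻¹ : Aˣ) * u i) * X ^ N i
  refine ⟨p, ?_, ?_⟩
  · have : p = X ^ N j + ∑ i ∈ S.erase j, C ((v⁻¹ : Aˣ) * u i) * X ^ N i := by
      unfold p
      rw [← Finset.add_sum_erase S (fun i => C ((v⁻¹ : Aˣ) * u i) * X ^ N i) hj, ← hv,
        Units.inv_mul, C_1, one_mul]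
    rw [this]
    refine monic_X_pow_add ((degree_sum_le _ _).trans_lt ?_)
    rw [Finset.sup_lt_iff (WithBot.bot_lt_coe _)]
    intro i hi
    refine (degree_C_mul_X_pow_le _ _).trans_lt ?_
    have hi' := Finset.mem_of_mem_erase hi
    have h1 := hjmax i hi'
    have h2 : l i ≠ l j := fun hij => Finset.ne_of_mem_erase hi (hl hi' hj hij)
    have h3 := hN i hi'
    have h4 := hN j hj
    have h5 : N i < N j := by omega
    exact_mod_cast h5
  · have : ∀ i ∈ S, f ((v⁻¹ : Aˣ) * u i) * (y : B) ^ N i =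
        f (v⁻¹ : Aˣ) * (y ^ (-l j') : Bˣ) * (f (u i) * (y ^ l i : Bˣ)) := by
      intro i hi
      have : (y : B) ^ N i = (y ^ (-l j') : Bˣ) * (y ^ l i : Bˣ) := by
        rw [← Units.val_mul, ← zpow_add, ← Units.val_pow_eq_pow_val, ← zpow_natCast, hN i hi,
          sub_eq_neg_add]
      rw [this, map_mul]
      ring
    rw [eval₂_finsetSum]
    simp only [eval₂_mul, eval₂_C, eval₂_X_pow]
    rw [Finset.sum_congr rfl this, ← Finset.mul_sum, h, mul_zero]

open Polynomial in
/-- Finitely many integer vectors are separated by a linear form with last coefficient `1`. -/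
theorem exists_injOn_last_add_sum {k : ℕ} (S : Finset (Fin (k + 1) → ℤ)) :
    ∃ a : Fin k → ℤ,
      Set.InjOn (fun ν : Fin (k + 1) → ℤ => ν (Fin.last k) + ∑ i, a i * ν i.castSucc) S := by
  classical
  -- The form with aᵢ = N^(i+1) takes the value P(v)(N) at v. An integer N outside the roots of the
  -- finitely many nonzero polynomials P(ν - μ) separates all of S.
  let P (v : Fin (k + 1) → ℤ) : ℤ[X] :=
    C (v (Fin.last k)) + ∑ i : Fin k, C (v i.castSucc) * X ^ ((i : ℕ) + 1)
  have hP : ∀ v, P v = 0 → v = 0 := by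
    intro v hv
    ext j
    refine Fin.lastCases ?_ (fun j => ?_) j
    · have := congrArg (fun p => p.coeff 0) hv
      simpa [P, coeff_X_pow] using this
    · have := congrArg (fun p => p.coeff ((j : ℕ) + 1)) hv
      simpa [P, coeff_X_pow, -eq_intCast, coeff_C_succ, Fin.val_inj] using this
  let Q : ℤ[X] := ∏ p ∈ S.offDiag, P (p.1 - p.2)
  have hQ : Q ≠ 0 := by
    refine Finset.prod_ne_zero_iff.2 fun p hp h => ?_
    exact (Finset.mem_offDiag.1 hp).2.2 (sub_eq_zero.1 (hP _ h))
  obtain ⟨N, hN⟩ : ∃ N : ℤ, Q.eval N ≠ 0 := by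
    by_contra! h
    exact hQ (Polynomial.funext (by simpa using h))
  refine ⟨fun i => N ^ ((i : ℕ) + 1), fun ν hν μ hμ h => ?_⟩
  by_contra hne
  rw [eval_prod] at hN
  refine Finset.prod_ne_zero_iff.1 hN (ν, μ) (Finset.mem_offDiag.2 ⟨hν, hμ, hne⟩) ?_
  have : ∑ i : Fin k, (ν i.castSucc - μ i.castSucc) * N ^ ((i : ℕ) + 1) =
      ∑ i : Fin k, N ^ ((i : ℕ) + 1) * ν i.castSucc -
        ∑ i : Fin k, N ^ ((i : ℕ) + 1) * μ i.castSucc := by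
    rw [← Finset.sum_sub_distrib]
    exact Finset.sum_congr rfl fun i _ => by ring
  simp only [P, eval_add, eval_C, eval_finsetSum, eval_mul, eval_pow, eval_X, Pi.sub_apply, this]
  linear_combination h

/-- The shear `ν ↦ (ν₁, …, νₖ, νₖ₊₁ + ∑ i, aᵢ νᵢ)`. -/
def shear {k : ℕ} (a : Fin k → ℤ) : (Fin (k + 1) → ℤ) ≃+ (Fin (k + 1) → ℤ) where
  toFun ν := Fin.snoc (Fin.init ν) (ν (Fin.last k) + ∑ i, a i * ν i.castSucc)
  invFun ν := Fin.snoc (Fin.init ν) (ν (Fin.last k) - ∑ i, a i * ν i.castSucc)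
  left_inv ν := by ext j; refine Fin.lastCases ?_ (fun j => ?_) j <;> simp [Fin.init]
  right_inv ν := by ext j; refine Fin.lastCases ?_ (fun j => ?_) j <;> simp [Fin.init]
  map_add' ν μ := by
    ext j
    refine Fin.lastCases ?_ (fun j => ?_) j
    · simp [mul_add, Finset.sum_add_distrib]; ring
    · simp [Fin.init]

theorem shear_apply_last {k : ℕ} (a : Fin k → ℤ) (ν : Fin (k + 1) → ℤ) :
    shear a ν (Fin.last k) = ν (Fin.last k) + ∑ i, a i * ν i.castSucc := by simp [shear]

/-- The ring homomorphism of Laurent polynomial rings induced by a homomorphism of the exponents. -/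
noncomputable abbrev mapExp {m n : ℕ} (e : (Fin m → ℤ) →+ (Fin n → ℤ)) : Laurent m →+* Laurent n :=
  AddMonoidAlgebra.mapDomainRingHom ℝ e

theorem mapExp_single {m n : ℕ} (e : (Fin m → ℤ) →+ (Fin n → ℤ)) (ν : Fin m → ℤ) (a : ℝ) :
    mapExp e (AddMonoidAlgebra.single ν a) = AddMonoidAlgebra.single (e ν) a :=
  AddMonoidAlgebra.mapDomain_single

theorem mapExp_comp {l m n : ℕ} (e : (Fin m → ℤ) →+ (Fin n → ℤ)) (e' : (Fin l → ℤ) →+ (Fin m → ℤ)) :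
    mapExp (e.comp e') = (mapExp e).comp (mapExp e') :=
  AddMonoidAlgebra.mapDomainRingHom_comp ..

theorem isUnit_single {n : ℕ} (ν : Fin n → ℤ) {a : ℝ} (ha : a ≠ 0) :
    IsUnit (AddMonoidAlgebra.single ν a : Laurent n) :=
  .of_mul_eq_one (AddMonoidAlgebra.single (-ν) a⁻¹) (by
    rw [AddMonoidAlgebra.single_mul_single, mul_inv_cancel₀ ha, add_neg_cancel,
      AddMonoidAlgebra.one_def])

/-- The unit `σ^ν` of the Laurent polynomial ring. -/
noncomputable def monomialUnit {n : ℕ} : Multiplicative (Fin n → ℤ) →* (Laurent n)ˣ :=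
  (AddMonoidAlgebra.of ℝ (Fin n → ℤ)).toHomUnits

theorem monomialUnit_zpow {n : ℕ} (ν : Fin n → ℤ) (k : ℤ) :
    ((monomialUnit (Multiplicative.ofAdd ν) ^ k : (Laurent n)ˣ) : Laurent n) =
      AddMonoidAlgebra.single (k • ν) 1 := by
  rw [← map_zpow, ← ofAdd_zsmul]
  rfl

theorem eq_extendZero_init_add {k : ℕ} (ν : Fin (k + 1) → ℤ) :
    ν = extendZero k (k + 1) (Fin.init ν) + ν (Fin.last k) • Pi.single (Fin.last k) 1 := by
  ext j
  refine Fin.lastCases ?_ (fun j => ?_) j <;> simp [extendZero, Fin.init]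

/-- This eliminates one variable. A shear gives the monomials of a nonzero f in the kernel pairwise
distinct last exponents, so f = 0 in B is a relation for the last variable in which each coefficient
is a single monomial, hence a unit. -/
theorem exists_isIntegral_comp_of_not_injective {B : Type*} [CommRing B] {k : ℕ}
    (g : Laurent (k + 1) →+* B) (hg : g.IsIntegral) (hker : ¬ Function.Injective g) :
    ∃ e : (Fin (k + 1) → ℤ) ≃+ (Fin (k + 1) → ℤ),
      (g.comp (mapExp (e.toAddMonoidHom.comp (extendZero k (k + 1))))).IsIntegral := by
  obtain ⟨f, hf, hf0⟩ : ∃ f, g f = 0 ∧ f ≠ 0 := by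
    rw [injective_iff_map_eq_zero] at hker
    push Not at hker
    exact hker
  obtain ⟨a, ha⟩ := exists_injOn_last_add_sum f.coeff.support
  let e := shear a
  refine ⟨e.symm, ?_⟩
  set h := g.comp (mapExp (e.symm.toAddMonoidHom.comp (extendZero k (k + 1)))) with hh
  let z : Bˣ := Units.map (g.comp (mapExp e.symm.toAddMonoidHom)).toMonoidHom
    (monomialUnit (Multiplicative.ofAdd (Pi.single (Fin.last k) 1)))
  have hsingle : ∀ ν c, g (AddMonoidAlgebra.single ν c) =
      h (AddMonoidAlgebra.single (Fin.init (e ν)) c) * (z ^ (e ν (Fin.last k)) : Bˣ) := by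
    intro ν c
    have : ((z ^ (e ν (Fin.last k)) : Bˣ) : B) = g (mapExp e.symm.toAddMonoidHom
        (AddMonoidAlgebra.single (e ν (Fin.last k) • Pi.single (Fin.last k) 1) 1)) := by
      rw [← map_zpow, ← monomialUnit_zpow]
      rfl
    rw [this, hh, mapExp_comp, RingHom.comp_apply, RingHom.comp_apply, ← map_mul, ← map_mul,
      mapExp_single, AddMonoidAlgebra.single_mul_single, mul_one, ← eq_extendZero_init_add,
      mapExp_single]
    simp
  have hz0 : ∑ ν ∈ f.coeff.support, h (AddMonoidAlgebra.single (Fin.init (e ν)) (f.coeff ν)) *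
      (z ^ (e ν (Fin.last k)) : Bˣ) = 0 := by
    rw [← hf]
    conv_rhs => rw [← AddMonoidAlgebra.sum_coeff_single f, Finsupp.sum, map_sum]
    exact Finset.sum_congr rfl fun ν _ => (hsingle ν _).symm
  have hne : f.coeff.support.Nonempty := by
    rwa [Finsupp.support_nonempty_iff, ne_eq, AddMonoidAlgebra.coeff_eq_zero]
  have hinj : Set.InjOn (fun ν => e ν (Fin.last k)) f.coeff.support := by
    simpa only [e, shear_apply_last] using ha
  have hu : ∀ ν ∈ f.coeff.support,
      IsUnit (AddMonoidAlgebra.single (Fin.init (e ν)) (f.coeff ν) : Laurent k) :=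
    fun ν hν => isUnit_single _ (Finsupp.mem_support_iff.1 hν)
  have hz : h.IsIntegralElem (z : B) :=
    isIntegralElem_of_sum_zpow_eq_zero h z _ hne _ hu _ hinj hz0
  -- The same relation with negated exponents: all coefficients are units, so the lowest term can
  -- serve as the leading one.
  have hzinv : h.IsIntegralElem ((z⁻¹ : Bˣ) : B) := by
    refine isIntegralElem_of_sum_zpow_eq_zero h z⁻¹ _ hne _ hu (fun ν => -(e ν (Fin.last k)))
      (fun ν hν μ hμ hνμ => hinj hν hμ (neg_injective hνμ)) ?_
    simpa only [inv_zpow', neg_neg] using hz0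
  have hall : ∀ x, h.IsIntegralElem (g x) := by
    intro x
    induction x using AddMonoidAlgebra.induction_linear with
    | zero => simpa using h.isIntegralElem_zero
    | add x y hx hy => simpa using hx.add h hy
    | single ν c =>
      rw [hsingle]
      refine h.isIntegralElem_map.mul h ?_
      generalize e ν (Fin.last k) = m
      algebraize [h]
      obtain ⟨m, rfl | rfl⟩ := m.eq_nat_or_neg
      · rw [zpow_natCast, Units.val_pow_eq_pow_val]
        exact IsIntegral.pow (R := Laurent k) hz m
      · rw [← inv_zpow', zpow_natCast, Units.val_pow_eq_pow_val]
        exact IsIntegral.pow (R := Laurent k) hzinv m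
  algebraize [h]
  intro y
  obtain ⟨p, hp, hpy⟩ := hg y
  -- The image of g lies in the integral closure, so a monic equation over g has coefficients there
  -- and transitivity of integrality applies.
  let g' : Laurent (k + 1) →+* integralClosure (Laurent k) B := g.codRestrict _ hall
  refine isIntegral_trans (R := Laurent k) (A := integralClosure (Laurent k) B) y
    ⟨p.map g', hp.map _, ?_⟩
  rw [Polynomial.eval₂_map]
  exact hpy

theorem mapExp_id (n : ℕ) : mapExp (.id (Fin n → ℤ)) = .id _ :=
  AddMonoidAlgebra.mapDomainRingHom_id

theorem extendZero_self (n : ℕ) : extendZero n n = .id _ := by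
  ext ν i
  simp [extendZero]

theorem extendZero_comp {d k n : ℕ} (h : d ≤ k) :
    (extendZero k n).comp (extendZero d k) = extendZero d n := by
  ext ν i
  simp only [AddMonoidHom.comp_apply, extendZero, AddMonoidHom.coe_mk, ZeroHom.coe_mk]
  split_ifs <;> first | rfl | omega

/-- Extension of an automorphism of `ℤᵏ` to `ℤᵏ⁺¹` that fixes the last coordinate. -/
def extendAut {k : ℕ} (e : (Fin k → ℤ) ≃+ (Fin k → ℤ)) :
    (Fin (k + 1) → ℤ) ≃+ (Fin (k + 1) → ℤ) where
  toFun ν := Fin.snoc (e (Fin.init ν)) (ν (Fin.last k))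
  invFun ν := Fin.snoc (e.symm (Fin.init ν)) (ν (Fin.last k))
  left_inv ν := by simp
  right_inv ν := by simp
  map_add' ν μ := by
    have : Fin.init (ν + μ) = Fin.init ν + Fin.init μ := rfl
    ext j
    refine Fin.lastCases ?_ (fun j => ?_) j <;> simp [this]

theorem extendAut_extendZero {k : ℕ} (e : (Fin k → ℤ) ≃+ (Fin k → ℤ)) (ν : Fin k → ℤ) :
    extendAut e (extendZero k (k + 1) ν) = extendZero k (k + 1) (e ν) := by
  have : Fin.init (extendZero k (k + 1) ν) = ν := by
    ext j
    simp [extendZero, Fin.init]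
  ext j
  refine Fin.lastCases ?_ (fun j => ?_) j <;> simp [extendAut, this] <;> simp [extendZero]

/-- Noether normalization for quotients of Laurent polynomial rings, by automorphisms of the
exponents. -/
theorem exists_isIntegral_injective {B : Type*} [CommRing B] [Nontrivial B] (m : ℕ)
    (g : Laurent m →+* B) (hg : g.IsIntegral) :
    ∃ d ≤ m, ∃ e : (Fin m → ℤ) ≃+ (Fin m → ℤ),
      (g.comp (mapExp (e.toAddMonoidHom.comp (extendZero d m)))).IsIntegral ∧
      Function.Injective (g.comp (mapExp (e.toAddMonoidHom.comp (extendZero d m)))) := by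
  induction m with
  | zero =>
    refine ⟨0, le_rfl, .refl _, ?_⟩
    have : g.comp (mapExp ((AddEquiv.refl (Fin 0 → ℤ)).toAddMonoidHom.comp (extendZero 0 0))) =
        g := by
      rw [extendZero_self]
      exact (congrArg g.comp (mapExp_id 0)).trans g.comp_id
    rw [this]
    -- Without variables every nonzero element is a constant, hence a unit, and cannot map to zero
    -- in a nontrivial ring.
    refine ⟨hg, (injective_iff_map_eq_zero g).2 fun f hf => ?_⟩
    by_contra hne
    have hsub : f = AddMonoidAlgebra.single 0 (f.coeff 0) := by
      refine AddMonoidAlgebra.ext (Finsupp.ext fun ν => ?_)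
      rw [Subsingleton.elim ν 0]
      simp
    have hc : f.coeff 0 ≠ 0 := by
      intro h0
      rw [h0, AddMonoidAlgebra.single_zero] at hsub
      exact hne hsub
    have := (isUnit_single (0 : Fin 0 → ℤ) hc).map g
    rw [← hsub, hf] at this
    exact not_isUnit_zero this
  | succ k ih =>
    by_cases hinj : Function.Injective g
    · refine ⟨k + 1, le_rfl, .refl _, ?_⟩
      have : g.comp (mapExp ((AddEquiv.refl _).toAddMonoidHom.comp (extendZero (k + 1) (k + 1)))) =
          g := by
        rw [extendZero_self]
        exact (congrArg g.comp (mapExp_id _)).trans g.comp_id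
      rw [this]
      exact ⟨hg, hinj⟩
    · obtain ⟨e, he⟩ := exists_isIntegral_comp_of_not_injective g hg hinj
      obtain ⟨d, hd, e', he'⟩ := ih _ he
      -- Fixing the last coordinate makes the extension of e' commute with `extendZero`; e is
      -- applied after it.
      refine ⟨d, by omega, (extendAut e').trans e, ?_⟩
      have : (g.comp (mapExp (e.toAddMonoidHom.comp (extendZero k (k + 1))))).comp
          (mapExp (e'.toAddMonoidHom.comp (extendZero d k))) =
          g.comp (mapExp (((extendAut e').trans e).toAddMonoidHom.comp (extendZero d (k + 1)))) := by
        rw [RingHom.comp_assoc, ← mapExp_comp]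
        congr 2
        rw [← extendZero_comp (n := k + 1) hd]
        exact AddMonoidHom.ext fun ν => congrArg e (extendAut_extendZero e' _).symm
      rwa [← this]

end Noether

/-! ### Duality between equation modules and behaviors. -/

section Duality

variable {n q : ℕ}

theorem shiftAct_add (f g : Laurent n) (w : Traj n) :
    shiftAct (f + g) w = shiftAct f w + shiftAct g w := by
  funext ν
  exact Finsupp.sum_add_index' (by simp) (fun _ _ _ => add_mul _ _ _)

theorem shiftAct_zero (w : Traj n) : shiftAct 0 w = 0 := by
  funext ν
  exact Finsupp.sum_zero_index

theorem shiftAct_single (μ : Fin n → ℤ) (a : ℝ) (w : Traj n) (ν : Fin n → ℤ) :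
    shiftAct (AddMonoidAlgebra.single μ a) w ν = a * w (ν + μ) :=
  Finsupp.sum_single_index (by simp)

theorem shiftAct_single_mul (μ : Fin n → ℤ) (a : ℝ) (f : Laurent n) (w : Traj n)
    (ν : Fin n → ℤ) :
    shiftAct (AddMonoidAlgebra.single μ a * f) w ν = a * shiftAct f w (ν + μ) := by
  induction f using AddMonoidAlgebra.induction_linear with
  | zero => simp [shiftAct_zero]
  | add f g hf hg => simp only [mul_add, shiftAct_add, Pi.add_apply, hf, hg]
  | single κ b =>
    rw [AddMonoidAlgebra.single_mul_single, shiftAct_single, shiftAct_single, add_assoc, mul_assoc]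

theorem rowAct_add (r s : Fin q → Laurent n) (w : Fin q → Traj n) :
    rowAct (r + s) w = rowAct r w + rowAct s w := by
  simp [rowAct, shiftAct_add, Finset.sum_add_distrib]

theorem rowAct_zero (w : Fin q → Traj n) : rowAct (0 : Fin q → Laurent n) w = 0 := by
  simp [rowAct, shiftAct_zero]

theorem rowAct_single_smul (μ : Fin n → ℤ) (a : ℝ) (r : Fin q → Laurent n) (w : Fin q → Traj n)
    (ν : Fin n → ℤ) :
    rowAct ((AddMonoidAlgebra.single μ a : Laurent n) • r) w ν = a * rowAct r w (ν + μ) := by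
  simp [rowAct, Finset.sum_apply, shiftAct_single_mul, Finset.mul_sum]

/-- The module of equations satisfied by a trajectory. -/
noncomputable def equationsOf (w : Fin q → Traj n) :
    Submodule (Laurent n) (Fin q → Laurent n) where
  carrier := {r | rowAct r w = 0}
  add_mem' {r s} hr hs := by
    change rowAct _ w = 0
    rw [rowAct_add, hr, hs, add_zero]
  zero_mem' := rowAct_zero w
  smul_mem' c r hr := by
    change rowAct _ w = 0
    induction c using AddMonoidAlgebra.induction_linear with
    | zero => rw [zero_smul, rowAct_zero]
    | add f g hf hg => rw [add_smul, rowAct_add, hf, hg, add_zero]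
    | single μ a =>
      funext ν
      rw [rowAct_single_smul, show rowAct r w = 0 from hr]
      simp

theorem kerRep_eq_behavior {p : ℕ} (R : Matrix (Fin p) (Fin q) (Laurent n)) :
    kerRep R = behavior (Submodule.span (Laurent n) (Set.range fun k => R k)) := by
  ext w
  refine ⟨fun h => ?_, fun h k => h _ (Submodule.subset_span ⟨k, rfl⟩)⟩
  have : Submodule.span (Laurent n) (Set.range fun k => R k) ≤ equationsOf w := by
    rw [Submodule.span_le]
    rintro _ ⟨k, rfl⟩
    exact h k
  exact fun r hr => this hr

/-- The trajectory defined by a linear form on `𝒜^q`. -/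
noncomputable def trajOfDual (φ : Module.Dual ℝ (Fin q → Laurent n)) : Fin q → Traj n :=
  fun i μ => φ (Pi.single i (AddMonoidAlgebra.single μ 1))

/-- Trajectories are the real linear dual of 𝒜^q, with the shift as the transpose of multiplication
by a monomial. -/
theorem rowAct_trajOfDual (φ : Module.Dual ℝ (Fin q → Laurent n)) (r : Fin q → Laurent n)
    (ν : Fin n → ℤ) :
    rowAct r (trajOfDual φ) ν = φ ((AddMonoidAlgebra.single ν 1 : Laurent n) • r) := by
  have key : ∀ i (f : Laurent n), shiftAct f (trajOfDual φ i) ν =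
      φ (Pi.single i (AddMonoidAlgebra.single ν 1 * f)) := by
    intro i f
    induction f using AddMonoidAlgebra.induction_linear with
    | zero => simp [shiftAct_zero]
    | add f g hf hg => rw [shiftAct_add, Pi.add_apply, hf, hg, mul_add, Pi.single_add, map_add]
    | single μ a =>
      rw [shiftAct_single, AddMonoidAlgebra.single_mul_single, trajOfDual, ← smul_eq_mul a,
        ← map_smul, ← Pi.single_smul, AddMonoidAlgebra.smul_single, smul_eq_mul, mul_one, one_mul]
  rw [rowAct, Finset.sum_apply, Finset.sum_congr rfl fun i _ => key i (r i), ← map_sum]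
  congr 1
  exact Finset.univ_sum_single (fun i => AddMonoidAlgebra.single ν 1 * r i)

/-- A row that annihilates a behavior belongs to its equation module. -/
theorem mem_of_forall_mem_behavior {𝓡 : Submodule (Laurent n) (Fin q → Laurent n)}
    {v : Fin q → Laurent n} (h : ∀ w ∈ behavior 𝓡, rowAct v w = 0) : v ∈ 𝓡 := by
  by_contra hv
  -- A linear form that vanishes on 𝓡 but not at v is a trajectory of the behavior that violates the
  -- equation v.
  obtain ⟨φ, hφv, hφ⟩ := Submodule.exists_le_ker_of_notMem (p := 𝓡.restrictScalars ℝ) hv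
  have hw : trajOfDual φ ∈ behavior 𝓡 := fun r hr => by
    funext ν
    rw [rowAct_trajOfDual]
    exact hφ (𝓡.smul_mem _ hr)
  have := congrFun (h _ hw) 0
  rw [rowAct_trajOfDual, ← AddMonoidAlgebra.one_def, one_smul] at this
  exact hφv this

theorem behavior_injective : Function.Injective
    (behavior : Submodule (Laurent n) (Fin q → Laurent n) → Set (Fin q → Traj n)) := by
  intro 𝓡 𝓢 h
  refine le_antisymm (fun r hr => ?_) (fun r hr => ?_)
  · exact mem_of_forall_mem_behavior fun w hw => (h ▸ hw : w ∈ behavior 𝓡) r hr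
  · exact mem_of_forall_mem_behavior fun w hw => (h ▸ hw : w ∈ behavior 𝓢) r hr

end Duality

/-! ### Maximal minors and the annihilator of the cokernel. -/

section Minors

variable {n p q : ℕ}

theorem mem_annihilator_quotient_iff {A M : Type*} [CommRing A] [AddCommGroup M] [Module A M]
    {N : Submodule A M} {f : A} : f ∈ Module.annihilator A (M ⧸ N) ↔ ∀ v : M, f • v ∈ N := by
  rw [Module.mem_annihilator]
  refine ⟨fun h v => ?_, fun h m => ?_⟩
  · rw [← Submodule.Quotient.mk_eq_zero, Submodule.Quotient.mk_smul]
    exact h _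
  · obtain ⟨v, rfl⟩ := Submodule.Quotient.mk_surjective N m
    rw [← Submodule.Quotient.mk_smul, Submodule.Quotient.mk_eq_zero]
    exact h v

/-- Cramer's rule: the adjugate writes det · v as a combination of the selected rows. -/
theorem minorIdeal_le_annihilator (R : Matrix (Fin p) (Fin q) (Laurent n)) :
    minorIdeal R ≤ Module.annihilator (Laurent n)
      ((Fin q → Laurent n) ⧸ Submodule.span (Laurent n) (Set.range fun k => R k)) := by
  rw [minorIdeal, Ideal.span_le]
  rintro _ ⟨e, rfl⟩
  refine mem_annihilator_quotient_iff.2 fun v => ?_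
  have : (R.submatrix e id).det • v =
      Matrix.vecMul (Matrix.vecMul v (R.submatrix e id).adjugate) (R.submatrix e id) := by
    rw [Matrix.vecMul_vecMul, Matrix.adjugate_mul, Matrix.vecMul_smul, Matrix.vecMul_one]
  rw [this, Matrix.vecMul_eq_sum]
  exact Submodule.sum_mem _ fun i _ =>
    Submodule.smul_mem _ _ (Submodule.subset_span ⟨e i, rfl⟩)

/-- The ideal is defined by increasing row selections; sorting an injective selection changes only
the sign, and a repeated row gives zero. -/
theorem det_submatrix_mem_minorIdeal (R : Matrix (Fin p) (Fin q) (Laurent n))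
    (κ : Fin q → Fin p) : (R.submatrix κ id).det ∈ minorIdeal R := by
  by_cases hκ : Function.Injective κ
  · let π := Tuple.sort κ
    have hmono : StrictMono (κ ∘ π) :=
      (Tuple.monotone_sort κ).strictMono_of_injective (hκ.comp π.injective)
    have hmem : (R.submatrix (κ ∘ π) id).det ∈ minorIdeal R :=
      Ideal.subset_span ⟨OrderEmbedding.ofStrictMono _ hmono, rfl⟩
    have hdet := Matrix.det_permute π (R.submatrix κ id)
    rw [Matrix.submatrix_submatrix, Function.id_comp] at hdet
    have : (R.submatrix κ id).det =
        (Equiv.Perm.sign π : ℤˣ) * (R.submatrix (κ ∘ π) id).det := by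
      rw [hdet, ← mul_assoc, ← Int.cast_mul, ← Units.val_mul, Int.units_mul_self]
      simp
    rw [this]
    exact Ideal.mul_mem_left _ _ hmem
  · obtain ⟨i, j, hij, hne⟩ : ∃ i j, κ i = κ j ∧ i ≠ j := by
      simpa [Function.Injective] using hκ
    rw [Matrix.det_zero_of_row_eq hne (by funext l; simp [hij])]
    exact zero_mem _

/-- Each f eᵢ is a combination of rows of R, so f^q = det(f · 1) expands multilinearly into
determinants of row selections. -/
theorem pow_mem_minorIdeal (R : Matrix (Fin p) (Fin q) (Laurent n)) {f : Laurent n}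
    (hf : f ∈ Module.annihilator (Laurent n)
      ((Fin q → Laurent n) ⧸ Submodule.span (Laurent n) (Set.range fun k => R k))) :
    f ^ q ∈ minorIdeal R := by
  have h := fun i => (Submodule.mem_span_range_iff_exists_fun _).1
    (mem_annihilator_quotient_iff.1 hf (Pi.single i 1))
  choose C hC using h
  have hdet : f ^ q = Matrix.det (Matrix.of fun i => ∑ k, C i k • R k) := by
    have : (Matrix.of fun i => ∑ k, C i k • R k) = f • (1 : Matrix (Fin q) (Fin q) (Laurent n)) := by
      funext i
      change ∑ k, C i k • R k = _
      rw [hC]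
      funext j
      simp [Matrix.one_apply, Pi.single_apply, eq_comm]
    rw [this, Matrix.det_smul, Matrix.det_one, mul_one, Fintype.card_fin]
  rw [hdet]
  change Matrix.detRowAlternating.toMultilinearMap (fun i => ∑ k, C i k • R k) ∈ _
  rw [MultilinearMap.map_sum]
  refine Submodule.sum_mem _ fun κ _ => ?_
  rw [MultilinearMap.map_smul_univ]
  exact Ideal.mul_mem_left _ _ (det_submatrix_mem_minorIdeal R κ)

theorem exists_matrix_span_eq (𝓝 : Submodule (Laurent n) (Fin q → Laurent n)) :
    ∃ (p : ℕ) (R : Matrix (Fin p) (Fin q) (Laurent n)),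
      Submodule.span (Laurent n) (Set.range fun k => R k) = 𝓝 :=
  Submodule.fg_iff_exists_fin_generating_family.1 (IsNoetherian.noetherian 𝓝)

/-- A behavior is autonomous if and only if its equation module has torsion cokernel. -/
theorem isAutonomous_behavior_iff (𝓝 : Submodule (Laurent n) (Fin q → Laurent n)) :
    IsAutonomous (behavior 𝓝) ↔
      Module.annihilator (Laurent n) ((Fin q → Laurent n) ⧸ 𝓝) ≠ ⊥ := by
  constructor
  · rintro ⟨p, R, hR, hne⟩ h
    rw [kerRep_eq_behavior] at hR
    obtain rfl := behavior_injective hR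
    exact hne (le_bot_iff.1 (h ▸ minorIdeal_le_annihilator R))
  · intro h
    obtain ⟨p, R, rfl⟩ := exists_matrix_span_eq 𝓝
    obtain ⟨f, hf, hf0⟩ := Submodule.exists_mem_ne_zero_of_ne_bot h
    refine ⟨p, R, (kerRep_eq_behavior R).symm, fun hbot => pow_ne_zero q hf0 ?_⟩
    simpa [hbot] using pow_mem_minorIdeal R hf

end Minors

/-! ### Finite generation and presentations over a smaller ring. -/

section FinGen

variable {A B C M : Type*} [CommRing A] [CommRing B] [CommRing C] [AddCommGroup M] [Module B M]

/-- Forward, Cayley–Hamilton for multiplication by b on M. Backward, B/ann M is integral and of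
finite type over A, hence finite, and M is finite over it. -/
theorem finGenOver_iff_isIntegral [Module.Finite B M] (f : A →+* B) (hf : f.FiniteType) :
    FinGenOver f M ↔ ((Ideal.Quotient.mk (Module.annihilator B M)).comp f).IsIntegral := by
  algebraize [f]
  let _ : Module A M := Module.compHom M f
  have : IsScalarTower A B M := ⟨fun a b m => mul_smul (f a) b m⟩
  constructor
  · intro (h : Module.Finite A M) x
    obtain ⟨b, rfl⟩ := Ideal.Quotient.mk_surjective x
    obtain ⟨p, hp, hpb⟩ := LinearMap.exists_monic_and_aeval_eq_zero A
      (Algebra.lsmul A A M b : Module.End A M)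
    refine ⟨p, hp, ?_⟩
    rw [← Polynomial.hom_eval₂, Ideal.Quotient.eq_zero_iff_mem, Module.mem_annihilator]
    intro m
    rw [Polynomial.aeval_algHom_apply] at hpb
    exact LinearMap.congr_fun hpb m
  · intro h
    have hfin := h.to_finite (RingHom.FiniteType.comp
      (RingHom.FiniteType.of_surjective _ Ideal.Quotient.mk_surjective) hf)
    let _ : Module (B ⧸ Module.annihilator B M) M := Module.quotientAnnihilator
    have : IsScalarTower B (B ⧸ Module.annihilator B M) M :=
      ⟨fun b x m => by
        obtain ⟨c, rfl⟩ := Ideal.Quotient.mk_surjective x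
        exact mul_smul b c m⟩
    have : IsScalarTower A (B ⧸ Module.annihilator B M) M :=
      ⟨fun a x m => by
        obtain ⟨c, rfl⟩ := Ideal.Quotient.mk_surjective x
        exact mul_smul (f a) c m⟩
    have : Module.Finite (B ⧸ Module.annihilator B M) M :=
      Module.Finite.of_restrictScalars_finite B _ _
    have : Module.Finite A (B ⧸ Module.annihilator B M) := hfin
    exact Module.Finite.trans (R := A) (B ⧸ Module.annihilator B M) M

theorem isIntegral_quotient_comap_iff (f : A →+* B) (φ : B →+* C) (hφ : Function.Surjective φ)
    (I : Ideal C) : ((Ideal.Quotient.mk (I.comap φ)).comp f).IsIntegral ↔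
      ((Ideal.Quotient.mk I).comp (φ.comp f)).IsIntegral := by
  have key : ∀ (b : B) (p : Polynomial A),
      p.eval₂ ((Ideal.Quotient.mk (I.comap φ)).comp f) (Ideal.Quotient.mk (I.comap φ) b) = 0 ↔
        p.eval₂ ((Ideal.Quotient.mk I).comp (φ.comp f)) (Ideal.Quotient.mk I (φ b)) = 0 := by
    intro b p
    rw [← Polynomial.hom_eval₂, ← Polynomial.hom_eval₂, ← Polynomial.hom_eval₂,
      Ideal.Quotient.eq_zero_iff_mem, Ideal.Quotient.eq_zero_iff_mem, Ideal.mem_comap]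
  constructor
  · intro h x
    obtain ⟨c, rfl⟩ := Ideal.Quotient.mk_surjective x
    obtain ⟨b, rfl⟩ := hφ c
    obtain ⟨p, hp, hpb⟩ := h (Ideal.Quotient.mk _ b)
    exact ⟨p, hp, (key b p).1 hpb⟩
  · intro h x
    obtain ⟨b, rfl⟩ := Ideal.Quotient.mk_surjective x
    obtain ⟨p, hp, hpb⟩ := h (Ideal.Quotient.mk _ (φ b))
    exact ⟨p, hp, (key b p).2 hpb⟩

/-- The generators identify A^γ modulo the rows of X with M as A-modules. -/
theorem IsPresentation.mem_annihilator_iff {f : A →+* B} {γ δ : ℕ} {g : Fin γ → M}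
    {X : Matrix (Fin δ) (Fin γ) A} (h : IsPresentation f g X) (c : A) :
    c ∈ Module.annihilator A
      ((Fin γ → A) ⧸ Submodule.span A (Set.range fun k => X k)) ↔
      f c ∈ Module.annihilator B M := by
  let _ : Module A M := Module.compHom M f
  obtain ⟨hg, hX⟩ := h
  rw [mem_annihilator_quotient_iff, Module.mem_annihilator, hX]
  rw [← Fintype.range_linearCombination A] at hg
  have hsurj := LinearMap.range_eq_top.1 hg
  simp only [LinearMap.mem_ker, map_smul]
  exact ⟨fun h m => by obtain ⟨v, rfl⟩ := hsurj m; exact h v, fun h v => h _⟩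

theorem exists_isPresentation [IsNoetherianRing A] {f : A →+* B} (h : FinGenOver f M) :
    ∃ (γ δ : ℕ) (g : Fin γ → M) (X : Matrix (Fin δ) (Fin γ) A), IsPresentation f g X := by
  let _ : Module A M := Module.compHom M f
  obtain ⟨γ, g, hg⟩ := Submodule.fg_iff_exists_fin_generating_family.1
    (Module.Finite.fg_top (self := h))
  obtain ⟨δ, X, hX⟩ := Submodule.fg_iff_exists_fin_generating_family.1
    (IsNoetherian.noetherian (LinearMap.ker (Fintype.linearCombination A g)))
  exact ⟨γ, δ, g, X, hg, hX⟩

end FinGen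

/-! ### Unimodular changes of variables. -/

section Transform

variable {n q : ℕ}

theorem phi_inv_phi (T : Matrix.GeneralLinearGroup (Fin n) ℤ) (f : Laurent n) :
    phi ((T⁻¹ : Matrix.GeneralLinearGroup (Fin n) ℤ) : Matrix (Fin n) (Fin n) ℤ)
      (phi (T : Matrix (Fin n) (Fin n) ℤ) f) = f := by
  simpa using phi_phi_inv T⁻¹ f

theorem mem_transform_iff (T : Matrix.GeneralLinearGroup (Fin n) ℤ)
    (𝓡 : Submodule (Laurent n) (Fin q → Laurent n)) (v : Fin q → Laurent n) :
    v ∈ transform T 𝓡 ↔ (fun i => phi ((T⁻¹ : Matrix.GeneralLinearGroup (Fin n) ℤ) :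
      Matrix (Fin n) (Fin n) ℤ) (v i)) ∈ 𝓡 := by
  constructor
  · rintro ⟨r, hr, rfl⟩
    simp only [phi_inv_phi]
    exact hr
  · intro h
    exact ⟨_, h, by simp only [phi_phi_inv]⟩

/-- The homomorphism `φ_{T⁻¹}`. -/
noncomputable abbrev phiInv (T : Matrix.GeneralLinearGroup (Fin n) ℤ) : Laurent n →+* Laurent n :=
  (phi ((T⁻¹ : Matrix.GeneralLinearGroup (Fin n) ℤ) : Matrix (Fin n) (Fin n) ℤ)).toRingHom

theorem phiInv_surjective (T : Matrix.GeneralLinearGroup (Fin n) ℤ) :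
    Function.Surjective (phiInv T) := fun f => ⟨_, phi_inv_phi T f⟩

theorem annihilator_quotient_transform (T : Matrix.GeneralLinearGroup (Fin n) ℤ)
    (𝓡 : Submodule (Laurent n) (Fin q → Laurent n)) :
    Module.annihilator (Laurent n) ((Fin q → Laurent n) ⧸ transform T 𝓡) =
      (Module.annihilator (Laurent n) ((Fin q → Laurent n) ⧸ 𝓡)).comap (phiInv T) := by
  ext f
  rw [Ideal.mem_comap, mem_annihilator_quotient_iff, mem_annihilator_quotient_iff]
  simp only [mem_transform_iff, Pi.smul_apply, smul_eq_mul, map_mul]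
  refine ⟨fun h v => ?_, fun h v => h _⟩
  have := h fun i => phi (T : Matrix (Fin n) (Fin n) ℤ) (v i)
  simp only [phi_inv_phi] at this
  exact this

theorem exists_phiInv_eq_mapExp (e : (Fin n → ℤ) ≃+ (Fin n → ℤ)) :
    ∃ T : Matrix.GeneralLinearGroup (Fin n) ℤ, phiInv T = mapExp e.toAddMonoidHom := by
  let S : Matrix.GeneralLinearGroup (Fin n) ℤ := Matrix.GeneralLinearGroup.toLin.symm
    (LinearMap.GeneralLinearGroup.ofLinearEquiv e.toIntLinearEquiv)
  -- The inverse appears because `phiInv` inverts its argument.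
  refine ⟨S⁻¹, ?_⟩
  have hS : (S : Matrix (Fin n) (Fin n) ℤ) = LinearMap.toMatrix' e.toIntLinearEquiv.toLinearMap :=
    rfl
  have : (S : Matrix (Fin n) (Fin n) ℤ).mulVecLin.toAddMonoidHom = e.toAddMonoidHom := by
    rw [hS, ← Matrix.toLin'_apply', Matrix.toLin'_toMatrix']
    rfl
  rw [← this, phiInv, inv_inv]
  rfl

end Transform

/-! ### The Nullstellensatz on the torus and the dimension of zero sets. -/

section Variety

variable {n : ℕ}

/-- The inclusion of the real into the complex Laurent polynomials. -/
noncomputable abbrev complexify (n : ℕ) : Laurent n →+* AddMonoidAlgebra ℂ (Fin n → ℤ) :=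
  AddMonoidAlgebra.mapRingHom _ (algebraMap ℝ ℂ)

theorem evalAt_single (K : Type) [CommSemiring K] [Algebra K ℂ] (ξ : Fin n → ℂˣ) (ν : Fin n → ℤ)
    (a : K) : evalAt K ξ (AddMonoidAlgebra.single ν a) =
      algebraMap K ℂ a * ((∏ i, ξ i ^ ν i : ℂˣ) : ℂ) := by
  rw [evalAt, AddMonoidAlgebra.lift_single, Algebra.smul_def]
  rfl

theorem evalAt_complexify (ξ : Fin n → ℂˣ) (f : Laurent n) :
    evalAt ℂ ξ (complexify n f) = evalAt ℝ ξ f := by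
  induction f using AddMonoidAlgebra.induction_linear with
  | zero => simp
  | add f g hf hg => rw [map_add, map_add, map_add, hf, hg]
  | single ν a => rw [AddMonoidAlgebra.mapRingHom_single, evalAt_single, evalAt_single]; rfl

theorem complexify_isIntegral (n : ℕ) : (complexify n).IsIntegral := by
  let _ : Algebra (Laurent n) (AddMonoidAlgebra ℂ (Fin n → ℤ)) := (complexify n).toAlgebra
  have hmap : ∀ ν, AddMonoidAlgebra.single ν 1 ∈
      integralClosure (Laurent n) (AddMonoidAlgebra ℂ (Fin n → ℤ)) := by
    intro ν
    have : AddMonoidAlgebra.single ν 1 = algebraMap (Laurent n) (AddMonoidAlgebra ℂ (Fin n → ℤ))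
        (AddMonoidAlgebra.single ν 1) := by
      rw [RingHom.algebraMap_toAlgebra, AddMonoidAlgebra.mapRingHom_single, map_one]
    rw [this]
    exact Subalgebra.algebraMap_mem _ _
  intro x
  refine map_mem_of_forall_single (RingHom.id _)
    (integralClosure (Laurent n) (AddMonoidAlgebra ℂ (Fin n → ℤ))).toSubring (fun a => ?_)
    (fun i => hmap _) (fun i => hmap _) x
  obtain ⟨p, hp, hpa⟩ := Algebra.IsIntegral.isIntegral (R := ℝ) a
  refine ⟨p.map (algebraMap ℝ (Laurent n)), hp.map _, ?_⟩
  have hcomp : (algebraMap (Laurent n) (AddMonoidAlgebra ℂ (Fin n → ℤ))).comp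
      (algebraMap ℝ (Laurent n)) = (AddMonoidAlgebra.singleZeroRingHom).comp (algebraMap ℝ ℂ) :=
    RingHom.ext fun b => AddMonoidAlgebra.mapRingHom_single ..
  rw [Polynomial.eval₂_map, hcomp]
  change Polynomial.eval₂ _ (AddMonoidAlgebra.singleZeroRingHom a) p = 0
  rw [← Polynomial.hom_eval₂, hpa, map_zero]

/-- Monomials are units, so φ sends the variables to nonzero complex numbers; these are the
coordinates of ξ. -/
theorem exists_evalAt_eq (φ : Laurent n →ₐ[ℝ] ℂ) : ∃ ξ : Fin n → ℂˣ, evalAt ℝ ξ = φ := by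
  let ψ : Multiplicative (Fin n → ℤ) →* ℂˣ := (Units.map φ.toRingHom.toMonoidHom).comp monomialUnit
  refine ⟨fun i => ψ (Multiplicative.ofAdd (Pi.single i 1)),
    AlgHom.toLinearMap_injective (AddMonoidAlgebra.lhom_ext' fun ν => LinearMap.ext_ring ?_)⟩
  change evalAt ℝ _ (AddMonoidAlgebra.single ν 1) = φ (AddMonoidAlgebra.single ν 1)
  rw [evalAt_single, map_one, one_mul]
  have : ∏ i, ψ (Multiplicative.ofAdd (Pi.single i 1)) ^ ν i = ψ (Multiplicative.ofAdd ν) := by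
    simp only [← map_zpow, ← map_prod, ← ofAdd_zsmul, ← ofAdd_sum]
    congr 2
    refine (Finset.sum_congr rfl fun i _ => ?_).trans (Finset.univ_sum_single ν)
    rw [← Pi.single_smul, smul_eq_mul, mul_one]
  rw [this]
  rfl

/-- The Nullstellensatz for real Laurent polynomials and points of the complex torus. -/
theorem mem_radical_iff_forall_mem_zeroSet (I : Ideal (Laurent n)) (f : Laurent n) :
    f ∈ I.radical ↔ ∀ ξ ∈ zeroSet I, evalAt ℝ ξ f = 0 := by
  constructor
  · rintro ⟨k, hk⟩ ξ hξ
    have := hξ _ hk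
    rw [map_pow] at this
    exact eq_zero_of_pow_eq_zero this
  · intro h
    -- In a Jacobson ring it suffices to test membership in each maximal ideal J above I.
    rw [Ideal.radical_eq_jacobson, Ideal.jacobson, Ideal.mem_sInf]
    rintro J ⟨hIJ, hJ⟩
    let _ : Field (Laurent n ⧸ J) := Ideal.Quotient.field J
    -- By Zariski's lemma the residue field is finite over ℝ, so it embeds in ℂ and yields a torus
    -- point whose real vanishing ideal is J.
    have : Module.Finite ℝ (Laurent n ⧸ J) := finite_of_finite_type_of_isJacobsonRing _ _
    let σ : (Laurent n ⧸ J) →ₐ[ℝ] ℂ := IsAlgClosed.lift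
    obtain ⟨ξ, hξ⟩ := exists_evalAt_eq (σ.comp (Ideal.Quotient.mkₐ ℝ J))
    have hmem : ∀ g, evalAt ℝ ξ g = 0 ↔ g ∈ J := by
      intro g
      rw [hξ, AlgHom.comp_apply, map_eq_zero_iff σ σ.toRingHom.injective]
      exact Ideal.Quotient.eq_zero_iff_mem
    exact (hmem f).1 (h ξ fun g hg => (hmem g).2 (hIJ hg))

theorem comap_vanishingIdeal_zeroSet (I : Ideal (Laurent n)) :
    (vanishingIdeal (zeroSet I)).comap (complexify n) = I.radical := by
  ext f
  simp only [Ideal.mem_comap, vanishingIdeal, Ideal.mem_iInf, RingHom.mem_ker, evalAt_complexify,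
    mem_radical_iff_forall_mem_zeroSet]

/-- By the Nullstellensatz the vanishing ideal contracts to the radical of I, so the coordinate ring
is an injective integral extension of 𝒜/√I. -/
theorem varietyDim_zeroSet (I : Ideal (Laurent n)) :
    varietyDim (zeroSet I) = ringKrullDim (Laurent n ⧸ I) := by
  have hcomap := comap_vanishingIdeal_zeroSet I
  rw [← ringKrullDim_quotient_radical, varietyDim]
  refine ringKrullDim_eq_of_isIntegral_of_injective
    (Ideal.quotientMap (vanishingIdeal (zeroSet I)) (complexify n) hcomap.ge) ?_
    (Ideal.quotientMap_injective' hcomap.le)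
  refine RingHom.IsIntegral.tower_top (Ideal.Quotient.mk I.radical) _ ?_
  rw [Ideal.quotientMap_comp_mk]
  exact (complexify_isIntegral n).trans _ _
    (RingHom.isIntegral_of_surjective _ Ideal.Quotient.mk_surjective)

theorem zeroSet_minorIdeal {p q : ℕ} (R : Matrix (Fin p) (Fin q) (Laurent n)) :
    zeroSet (minorIdeal R) = zeroSet (Module.annihilator (Laurent n)
      ((Fin q → Laurent n) ⧸ Submodule.span (Laurent n) (Set.range fun k => R k))) := by
  ext ξ
  refine ⟨fun h f hf => ?_, fun h f hf => h f (minorIdeal_le_annihilator R hf)⟩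
  have := h _ (pow_mem_minorIdeal R hf)
  rw [map_pow] at this
  exact eq_zero_of_pow_eq_zero this

end Variety

/-! ### Translation to the twisted inclusion. -/

section Normalization

variable {n q : ℕ}

/-- The homomorphism through which `𝒜_{d'}` acts on `𝒜 ⧸ I` after the change of variables `T`. -/
noncomputable abbrev twistedIncl (I : Ideal (Laurent n)) (T : Matrix.GeneralLinearGroup (Fin n) ℤ)
    (d' : ℕ) : Laurent d' →+* Laurent n ⧸ I :=
  (Ideal.Quotient.mk I).comp ((phiInv T).comp (incl d' n))

theorem incl_finiteType (d' n : ℕ) : (incl d' n).FiniteType := by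
  have : ((incl d' n).comp (algebraMap ℝ (Laurent d'))) = algebraMap ℝ (Laurent n) := by
    refine RingHom.ext fun a => ?_
    refine (mapExp_single (extendZero d' n) 0 a).trans ?_
    rw [map_zero]
    rfl
  refine RingHom.FiniteType.of_comp_finiteType (f := algebraMap ℝ (Laurent d')) ?_
  rw [this, RingHom.finiteType_algebraMap]
  infer_instance

theorem finGenOver_transform_iff (𝓡 : Submodule (Laurent n) (Fin q → Laurent n))
    (T : Matrix.GeneralLinearGroup (Fin n) ℤ) (d' : ℕ) :
    FinGenOver (incl d' n) ((Fin q → Laurent n) ⧸ transform T 𝓡) ↔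
      (twistedIncl (Module.annihilator (Laurent n) ((Fin q → Laurent n) ⧸ 𝓡)) T d').IsIntegral := by
  rw [finGenOver_iff_isIntegral _ (incl_finiteType d' n), annihilator_quotient_transform,
    isIntegral_quotient_comap_iff _ _ (phiInv_surjective T)]

/-- The state space is non-autonomous if and only if `𝒜_{d'}` acts faithfully. -/
theorem not_isAutonomous_kerRep_iff {𝓡 : Submodule (Laurent n) (Fin q → Laurent n)}
    {T : Matrix.GeneralLinearGroup (Fin n) ℤ} {d' γ δ : ℕ}
    {g : Fin γ → (Fin q → Laurent n) ⧸ transform T 𝓡} {X : Matrix (Fin δ) (Fin γ) (Laurent d')}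
    (h : IsPresentation (incl d' n) g X) :
    ¬ IsAutonomous (kerRep X) ↔ Function.Injective
      (twistedIncl (Module.annihilator (Laurent n) ((Fin q → Laurent n) ⧸ 𝓡)) T d') := by
  rw [kerRep_eq_behavior, isAutonomous_behavior_iff, not_not, RingHom.injective_iff_ker_eq_bot]
  refine Eq.congr_left (Ideal.ext fun c => ?_)
  rw [h.mem_annihilator_iff, annihilator_quotient_transform, RingHom.mem_ker, Ideal.mem_comap,
    RingHom.comp_apply, Ideal.Quotient.eq_zero_iff_mem, RingHom.comp_apply]

theorem exists_twistedIncl_isIntegral_injective {I : Ideal (Laurent n)} (hI : I ≠ ⊤) :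
    ∃ d ≤ n, ∃ T : Matrix.GeneralLinearGroup (Fin n) ℤ,
      (twistedIncl I T d).IsIntegral ∧ Function.Injective (twistedIncl I T d) := by
  have := Ideal.Quotient.nontrivial_iff.2 hI
  obtain ⟨d, hd, e, he⟩ := exists_isIntegral_injective n (Ideal.Quotient.mk I)
    (RingHom.isIntegral_of_surjective _ Ideal.Quotient.mk_surjective)
  obtain ⟨T, hT⟩ := exists_phiInv_eq_mapExp e
  refine ⟨d, hd, T, ?_⟩
  rwa [twistedIncl, hT, incl, ← mapExp_comp]

theorem isIntegral_twistedIncl_of_le {I : Ideal (Laurent n)}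
    {T : Matrix.GeneralLinearGroup (Fin n) ℤ} {d d' : ℕ} (hd : d ≤ d')
    (h : (twistedIncl I T d).IsIntegral) : (twistedIncl I T d').IsIntegral := by
  refine RingHom.IsIntegral.tower_top (incl d d') _ ?_
  have : (incl d' n).comp (incl d d') = incl d n := by
    rw [incl, incl, incl, ← extendZero_comp (n := n) hd]
    exact (mapExp_comp _ _).symm
  rwa [RingHom.comp_assoc, RingHom.comp_assoc, this]

end Normalization

end NDSystems

/-! ### The dimension theorem. -/

open NDSystems
theorem mainTheorem7 (n q : ℕ) (𝓡 : Submodule (Laurent n) (Fin q → Laurent n))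
    (hB : IsAutonomous (behavior 𝓡)) (d : WithBot ℕ∞)
    (hd : ringKrullDim
      (Laurent n ⧸ Module.annihilator (Laurent n) ((Fin q → Laurent n) ⧸ 𝓡)) = d) :
    (∀ d' : ℕ, d' ≤ n → List.TFAE
      [∃ T : Matrix.GeneralLinearGroup (Fin n) ℤ,
          FinGenOver (incl d' n) ((Fin q → Laurent n) ⧸ transform T 𝓡) ∧
          ∀ (γ δ : ℕ) (g : Fin γ → (Fin q → Laurent n) ⧸ transform T 𝓡)
            (X : Matrix (Fin δ) (Fin γ) (Laurent d')),
            IsPresentation (incl d' n) g X → ¬ IsAutonomous (kerRep X),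
        ∃ T : Matrix.GeneralLinearGroup (Fin n) ℤ,
          FinGenOver (incl d' n) ((Fin q → Laurent n) ⧸ transform T 𝓡) ∧
          ∃ (γ δ : ℕ) (g : Fin γ → (Fin q → Laurent n) ⧸ transform T 𝓡)
            (X : Matrix (Fin δ) (Fin γ) (Laurent d')),
            IsPresentation (incl d' n) g X ∧ ¬ IsAutonomous (kerRep X),
        (d' : WithBot ℕ∞) = d]) ∧
    (∀ d' : ℕ, d' ≤ n →
      ((∃ T : Matrix.GeneralLinearGroup (Fin n) ℤ,
          FinGenOver (incl d' n) ((Fin q → Laurent n) ⧸ transform T 𝓡)) ↔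
        d ≤ (d' : WithBot ℕ∞))) ∧
    (∀ (p : ℕ) (R : Matrix (Fin p) (Fin q) (Laurent n)), behavior 𝓡 = kerRep R →
      varietyDim (zeroSet (minorIdeal R)) = d) := by
  subst hd
  set I := Module.annihilator (Laurent n) ((Fin q → Laurent n) ⧸ 𝓡) with hI
  have hdim : ∀ {T : Matrix.GeneralLinearGroup (Fin n) ℤ} {d₀ : ℕ},
      (twistedIncl I T d₀).IsIntegral → Function.Injective (twistedIncl I T d₀) →
      ringKrullDim (Laurent n ⧸ I) = d₀ := fun h h' => by
    rw [ringKrullDim_eq_of_isIntegral_of_injective _ h h', ringKrullDim_laurent]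
  refine ⟨fun d' _ => ?_, fun d' _ => ⟨?_, fun hle => ?_⟩, fun p R hR => ?_⟩
  · tfae_have 1 → 2 := by
      rintro ⟨T, hT, h⟩
      obtain ⟨γ, δ, g, X, hX⟩ := exists_isPresentation hT
      exact ⟨T, hT, γ, δ, g, X, hX, h γ δ g X hX⟩
    tfae_have 2 → 3 := by
      rintro ⟨T, hT, γ, δ, g, X, hX, h⟩
      exact (hdim ((finGenOver_transform_iff 𝓡 T d').1 hT)
        ((not_isAutonomous_kerRep_iff hX).1 h)).symm
    tfae_have 3 → 1 := by
      intro hd'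
      -- For I = 𝒜 the dimension is -∞, which no natural number d' equals.
      have htop : I ≠ ⊤ := by
        intro h
        have := Ideal.Quotient.subsingleton_iff.2 h
        rw [ringKrullDim_eq_bot_of_subsingleton] at hd'
        exact WithBot.coe_ne_bot hd'
      obtain ⟨d₀, -, T, hint, hinj⟩ := exists_twistedIncl_isIntegral_injective htop
      have h := hd'.trans (hdim hint hinj)
      obtain rfl : d' = d₀ := by exact_mod_cast h
      exact ⟨T, (finGenOver_transform_iff 𝓡 T d').2 hint,
        fun γ δ g X hX => (not_isAutonomous_kerRep_iff hX).2 hinj⟩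
    tfae_finish
  · rintro ⟨T, hT⟩
    exact (ringKrullDim_le_of_isIntegral _ ((finGenOver_transform_iff 𝓡 T d').1 hT)).trans
      (ringKrullDim_laurent d').le
  -- If the quotient ring is zero, every map to it is integral and T = 1 will do. Otherwise the
  -- normalization in d₀ = d variables stays integral when variables are added.
  · by_cases htop : I = ⊤
    · have := Ideal.Quotient.subsingleton_iff.2 htop
      exact ⟨1, (finGenOver_transform_iff 𝓡 1 d').2
        (RingHom.isIntegral_of_surjective _ fun x => ⟨0, Subsingleton.elim _ _⟩)⟩
    · obtain ⟨d₀, -, T, hint, hinj⟩ := exists_twistedIncl_isIntegral_injective htop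
      rw [hdim hint hinj] at hle
      exact ⟨T, (finGenOver_transform_iff 𝓡 T d').2
        (isIntegral_twistedIncl_of_le (by exact_mod_cast hle) hint)⟩
  · rw [kerRep_eq_behavior] at hR
    rw [zeroSet_minorIdeal, ← behavior_injective hR, varietyDim_zeroSet]
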